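/- Let $\sigma_1,\sigma_2$ be the standard generators of the braid group $B_3$, let $[1,3]=\sigma_1\sigma_2$, and let $\beta\cong\gamma$ mean that $\beta,\gamma\in B_3$ are conjugate. For $\beta\in B_3$ with exponent sum $w=w(\beta)$ and closure $\widehat\beta$, define the normalized Jones polynomial $V^*_{\widehat\beta}$ by $V_{\widehat\beta}(t)=t^{(w-2)/2}\,V^*_{\widehat\beta}(t)$, where $V$ is the Jones polynomial, normalized to be $1$ on the unknot, with $t^{-1}V_{D_+}-tV_{D_-}=(t^{1/2}-t^{-1/2})V_{D_0}$, and each $\sigma_i$ is a positive crossing. Put $\epsilon_k=(-1)^k$, $G=1+t+t^2$ and $A_k=(t^k+\epsilon_{k-1})/(t+1)$ for $k\in\mathbb Z$. Let $a,x,y$ be any integers. 1. If $\beta=[1,3]^{3a}\sigma_1^x\sigma_2^y$, then $$V^*_{\widehat\beta}=\epsilon_{x+y}(1+t^2)+t^{3a}\,\frac{t^{x+y+2}+\epsilon_xGt^{y+1}+\epsilon_yGt^{x+1}+\epsilon_{x+y}t^2}{(1+t)^2}$$ $$=\epsilon_{x+y}(1+t^2)+t^{3a+2}\{\epsilon_{x+y+1}+\epsilon_yA_{x-1}+\epsilon_xA_{y-1}+t^2A_{x-1}A_{y-1}\}.$$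 2. If $\beta=[1,3]^{3a+1}\sigma_1^x\sigma_2^y$, then $\beta\cong[1,3]^{3a}\sigma_1^{x+y+1}\sigma_2$ and $$V^*_{\widehat\beta}=\epsilon_{x+y}(1+t^2)-t^{3a+3}\,\frac{t^{x+y-1}+\epsilon_{x+y}}{1+t}=\epsilon_{x+y}(1+t^2)-t^{3a+3}A_{x+y-1}.$$ 3. If $\beta=[1,3]^{3a+2}\sigma_1^x\sigma_2^y$, then $\beta\cong[1,3]^{3a+3}\sigma_1^{x-1}\sigma_2^{y-1}$ and $$V^*_{\widehat\beta}=\epsilon_{x+y}(1+t^2)+t^{3a+3}\,\frac{t^{x+y}+\epsilon_{x-1}Gt^{y}+\epsilon_{y-1}Gt^{x}+\epsilon_{x+y}t^2}{(1+t)^2}.$$ -/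

import Mathlib

open LaurentPolynomial

namespace BraidJones

/-! ### Braids -/

/-- The relations of the Artin braid group on `n` strands, with generators `σ_i` indexed by
`i : Fin (n - 1)`; the generator with index `i` crosses the strands in positions `i`, `i + 1`. -/
inductive IsBraidRel (n : ℕ) : FreeGroup (Fin (n - 1)) → Prop
  | comm (i j : Fin (n - 1)) (h : i.val + 2 ≤ j.val) :
      IsBraidRel n (FreeGroup.of i * FreeGroup.of j * (FreeGroup.of j * FreeGroup.of i)⁻¹)
  | braid (i j : Fin (n - 1)) (h : i.val + 1 = j.val) :
      IsBraidRel n (FreeGroup.of i * FreeGroup.of j * FreeGroup.of i *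
        (FreeGroup.of j * FreeGroup.of i * FreeGroup.of j)⁻¹)

/-- The braid group `B_n`. -/
abbrev BraidGroup (n : ℕ) : Type := PresentedGroup {r | IsBraidRel n r}

/-- The generator `σ₁` of `B_3`. -/
def sigma₁ : BraidGroup 3 := PresentedGroup.of ⟨0, by omega⟩

/-- The generator `σ₂` of `B_3`. -/
def sigma₂ : BraidGroup 3 := PresentedGroup.of ⟨1, by omega⟩

/-- A braid word on `n` strands: the letter `(i, true)` is the generator `σ_i` (a positive
crossing), the letter `(i, false)` is its inverse (a negative crossing). -/
abbrev BraidWord (n : ℕ) : Type := List (Fin (n - 1) × Bool)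

/-- The braid represented by a braid word. -/
def BraidWord.toBraid {n : ℕ} (u : BraidWord n) : BraidGroup n :=
  PresentedGroup.mk {r | IsBraidRel n r} (FreeGroup.mk u)

/-- The writhe (exponent sum) of a braid word. -/
def BraidWord.writhe {n : ℕ} (u : BraidWord n) : ℤ :=
  (u.map fun c => if c.2 then (1 : ℤ) else -1).sum

/-! ### The Jones polynomial of the closure of a braid word

The closure of the braid word `u` on `n` strands has the standard closed braid diagram, with one
crossing for each letter. The point `(j, k)` is the point of the diagram in position `j` just
before the `k`-th crossing (`k` counted from `0`; the points at the last level come after all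
crossings). All strands are oriented in the direction of increasing `k`. -/

/-- A Kauffman state chooses one of the two smoothings at every crossing: `true` is the smoothing
that respects the orientation (two parallel strands), `false` is the other one (a cap and a cup). -/
abbrev BraidWord.State {n : ℕ} (u : BraidWord n) : Type := Fin u.length → Bool

/-- The arcs of the smoothed diagram that belongs to a state, as pairs of end points. -/
inductive BraidWord.StateArc {n : ℕ} (u : BraidWord n) (s : u.State) :
    Fin n × Fin (u.length + 1) → Fin n × Fin (u.length + 1) → Prop
  /-- A strand passes the `k`-th crossing straight, either because the crossing does not involve
  it, or because the crossing is smoothed to parallel strands. -/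
  | pass (k : Fin u.length) (j : Fin n)
      (h : s k = true ∨ (j.val ≠ (u.get k).1.val ∧ j.val ≠ (u.get k).1.val + 1)) :
      StateArc u s (j, k.castSucc) (j, k.succ)
  | cap (k : Fin u.length) (h : s k = false) (j j' : Fin n)
      (hj : j.val = (u.get k).1.val) (hj' : j'.val = (u.get k).1.val + 1) :
      StateArc u s (j, k.castSucc) (j', k.castSucc)
  | cup (k : Fin u.length) (h : s k = false) (j j' : Fin n)
      (hj : j.val = (u.get k).1.val) (hj' : j'.val = (u.get k).1.val + 1) :
      StateArc u s (j, k.succ) (j', k.succ)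
  /-- The closing strands. -/
  | close (j : Fin n) : StateArc u s (j, Fin.last u.length) (j, 0)

/-- The number of circles of the smoothed diagram: its points modulo the equivalence relation
generated by the arcs. -/
noncomputable def BraidWord.circles {n : ℕ} (u : BraidWord n) (s : u.State) : ℕ :=
  Nat.card (Quot (u.StateArc s))

/-- The Kauffman bracket of the closed braid diagram, as a Laurent polynomial in `A = T 1`,
with value `1` on a single circle. A positive crossing contributes `A` to the parallel smoothing
and `A⁻¹` to the other one, a negative crossing contributes the inverses; every circle but one
contributes `-A² - A⁻²`. -/
noncomputable def BraidWord.bracket {n : ℕ} (u : BraidWord n) : ℤ[T;T⁻¹] :=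
  ∑ s : u.State, (∏ k : Fin u.length, if s k = (u.get k).2 then T 1 else T (-1)) *
    (-T 2 - T (-2)) ^ (u.circles s - 1)

/-- The Jones polynomial of the closure of a braid word: `(-A³) ^ (-w)` times the bracket, where
`w` is the writhe. It is a Laurent polynomial in `A`; the usual variable is `t = A⁻⁴`, with
`t^{1/2} = A⁻²`. -/
noncomputable def BraidWord.jones {n : ℕ} (u : BraidWord n) : ℤ[T;T⁻¹] :=
  C (u.writhe.negOnePow : ℤ) * T (-3 * u.writhe) * u.bracket

/-- The field of fractions of `ℤ[A, A⁻¹]`. -/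
abbrev JonesField : Type := FractionRing ℤ[T;T⁻¹]

/-- The variable `t = A⁻⁴`. -/
noncomputable def t : JonesField := algebraMap ℤ[T;T⁻¹] JonesField (T (-4))

/-- The normalized Jones polynomial `V*` of the closure of a three-braid, determined by
`V = t^{(w - 2)/2} V*`; the factor `t^{-(w - 2)/2}` is `A^{2 (w - 2)}`. -/
noncomputable def BraidWord.normalizedJones (u : BraidWord 3) : JonesField :=
  algebraMap ℤ[T;T⁻¹] JonesField (T (2 * (u.writhe - 2)) * u.jones)

/-- The sign `ε_k = (-1)^k`. -/
noncomputable def eps (k : ℤ) : JonesField := (-1) ^ k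

/-- `A_k = (t^k + ε_{k-1}) / (t + 1)`. -/
noncomputable def altA (k : ℤ) : JonesField := (t ^ k + eps (k - 1)) / (t + 1)

/-- `G = 1 + t + t²`. -/
noncomputable def G : JonesField := 1 + t + t ^ 2

end BraidJones

/-!
The number of circles of a Kauffman state of a closed three-braid is determined by the product of
its smoothed crossings in the Temperley–Lieb algebra on three strands. Two-colourings of the
smoothed diagram show this: there are `2 ^ circles` of them, and level by level they are counted
by the trace of a product of transfer matrices, which form a representation with loop value `2`
(`two_pow_circles`). Products of the generators have a normal form `d ^ l * e`, the same in every
representation (`exists_normalForm`); comparing it in the transfer matrices and in a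
two-dimensional representation with loop value `d = -A² - A⁻²` expresses the weight
`d ^ (circles - 1)` of a state as the trace in the two-dimensional representation, plus `d² - 2`
if all smoothings are parallel (`loopValue_pow_circles`).

Summing over the states, the bracket becomes the trace of a product of `2 × 2` matrices plus
`A ^ w * (d² - 2)` (`map_bracket`). With the normalization of `V*` these matrices become the reduced
Burau matrices, whence `V* = ε_w (1 + t²) + t * tr (burau β)` (`normalizedJones_eq`), a conjugacy
invariant of the braid `β`. The full twist `(σ₁σ₂)³` acts as `t³` and the powers of a Burau
generator are explicit triangular matrices, which gives `V*` on `(σ₁σ₂)^{3a} σ₁^x σ₂^y`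
(`normalizedJones_of_toBraid_isConj`). The other two families are conjugate to braids of this form
(`isConj_fullTwist_mul_braid`, `isConj_fullTwist_mul_braid_sq`).
-/

namespace BraidJones

/-! ### Temperley–Lieb relations -/

/-- The relations of the Temperley–Lieb algebra on three strands, with loop value `d`. -/
structure IsTemperleyLieb {R : Type*} [Monoid R] (d : R) (e : Fin 2 → R) : Prop where
  comm (i : Fin 2) : Commute d (e i)
  mul_self (i : Fin 2) : e i * e i = d * e i
  mul_mul (i j : Fin 2) (h : i ≠ j) : e i * e j * e i = e i

/-- A product of `1`s and `eᵢ`s either has no factor `eᵢ`, or equals a power of `d` times one of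
`e₁`, `e₂`, `e₁e₂`, `e₂e₁`. The exponent and the element do not depend on the monoid, so the same
normal form can be read off in different representations. -/
theorem exists_normalForm (L : List (Fin 2 × Bool)) :
    (∀ p ∈ L, p.2 = true) ∨ ((∃ p ∈ L, p.2 = false) ∧ ∃ (l : ℕ) (i j : Fin 2),
      ∀ (R : Type) [Monoid R] (d : R) (e : Fin 2 → R), IsTemperleyLieb d e →
        (L.map fun p => if p.2 then 1 else e p.1).prod
          = d ^ l * if i = j then e i else e i * e j) := by
  induction L using List.reverseRecOn with
  | nil => simp
  | append_singleton L p ih =>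
    obtain ⟨k, b⟩ := p
    cases b with
    | true =>
      rcases ih with h | ⟨⟨p, hp, hb⟩, l, i, j, h⟩
      · left
        intro p hp
        rcases List.mem_append.1 hp with hp | hp
        · exact h p hp
        · rw [List.mem_singleton.1 hp]
      · exact .inr ⟨⟨p, List.mem_append_left _ hp, hb⟩, l, i, j, fun R _ d e he => by
          simp [← h R d e he]⟩
    | false =>
      refine .inr ⟨⟨(k, false), by simp, rfl⟩, ?_⟩
      rcases ih with h | ⟨-, l, i, j, h⟩
      · refine ⟨0, k, k, fun R _ d e he => ?_⟩
        rw [List.map_append, List.prod_append, List.prod_eq_one (l := L.map _)]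
        · simp
        · intro x hx
          obtain ⟨p, hp, rfl⟩ := List.mem_map.1 hx
          simp [h p hp]
      · refine ⟨if j = k then l + 1 else l, i, k, fun R _ d e he => ?_⟩
        rw [List.map_append, List.prod_append, h R d e he]
        simp only [List.map_cons, List.map_nil, List.prod_cons, List.prod_nil, mul_one, mul_assoc,
          Bool.false_eq_true, if_false]
        by_cases hjk : j = k
        · subst hjk
          by_cases hij : i = j
          · subst hij
            simp [he.mul_self, pow_succ, mul_assoc]
          · simp only [hij, if_false, if_true, mul_assoc, he.mul_self, pow_succ]
            rw [← mul_assoc (e i), ← (he.comm i).eq, mul_assoc]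
        · by_cases hij : i = j
          · subst hij
            simp [hjk]
          · -- there are only two indices, so the product closes up to `e i * e j * e i`
            have hik : i = k := by omega
            subst hik
            simp [hij, hjk, he.mul_mul i j hij]

/-! ### Sums over functions and products of matrices -/

theorem sum_prod_ofFn {ι R : Type*} [Fintype ι] [Semiring R] {n : ℕ} (g : Fin n → ι → R) :
    ∑ s : Fin n → ι, (List.ofFn fun k => g k (s k)).prod
      = (List.ofFn fun k => ∑ b, g k b).prod := by
  induction n with
  | zero => simp
  | succ n ih =>
    rw [← (Fin.consEquiv fun _ => ι).sum_comp, Fintype.sum_prod_type, List.ofFn_succ,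
      List.prod_cons, ← ih, Finset.sum_mul]
    simp [Fin.consEquiv, List.ofFn_succ, Finset.mul_sum]

theorem prod_ofFn_apply {ι R : Type*} [Fintype ι] [DecidableEq ι] [CommSemiring R] {n : ℕ}
    (M : Fin n → Matrix ι ι R) (a b : ι) :
    (List.ofFn M).prod a b = ∑ F : Fin (n + 1) → ι, if F 0 = a ∧ F (Fin.last n) = b then
      ∏ k, M k (F k.castSucc) (F k.succ) else 0 := by
  induction n generalizing a with
  | zero =>
    rw [← (Equiv.funUnique (Fin 1) ι).symm.sum_comp]
    simp [Matrix.one_apply, ite_and]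
  | succ n ih =>
    rw [List.ofFn_succ, List.prod_cons, Matrix.mul_apply,
      ← (Fin.consEquiv fun _ => ι).sum_comp, Fintype.sum_prod_type]
    simp only [ih, Fin.consEquiv, Equiv.coe_fn_mk, Fin.cons_zero, ← Fin.succ_last, Fin.cons_succ,
      Fin.prod_univ_succ, Fin.castSucc_zero, Finset.mul_sum]
    rw [Finset.sum_comm, Finset.sum_comm (s := Finset.univ (α := ι))]
    refine Finset.sum_congr rfl fun F _ => ?_
    simp only [ite_and, ← Fin.succ_castSucc, Fin.cons_succ, mul_ite, mul_zero,
      Finset.sum_ite_eq, Finset.sum_ite_eq', Finset.mem_univ, if_true]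

theorem trace_prod_ofFn {ι R : Type*} [Fintype ι] [DecidableEq ι] [CommSemiring R] {n : ℕ}
    (M : Fin n → Matrix ι ι R) :
    (List.ofFn M).prod.trace = ∑ F : Fin (n + 1) → ι, if F (Fin.last n) = F 0 then
      ∏ k, M k (F k.castSucc) (F k.succ) else 0 := by
  simp only [Matrix.trace, Matrix.diag, prod_ofFn_apply]
  rw [Finset.sum_comm]
  refine Finset.sum_congr rfl fun F _ => ?_
  simp [ite_and]

/-! ### Counting circles by colourings -/

/-- The number of classes, found by counting the two-colourings that are constant on classes. -/
theorem two_pow_card_quot {α : Type*} [Finite α] (r : α → α → Prop) :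
    2 ^ Nat.card (Quot r) = Nat.card {f : α → Bool // ∀ a b, r a b → f a = f b} := by
  have : Finite (Quot r) := Quot.finite r
  have e : (Quot r → Bool) ≃ {f : α → Bool // ∀ a b, r a b → f a = f b} :=
    { toFun := fun g => ⟨fun a => g (Quot.mk r a), fun a b h => congrArg g (Quot.sound h)⟩
      invFun := fun f => Quot.lift f.1 f.2
      left_inv := fun g => funext fun q => Quot.inductionOn q fun _ => rfl
      right_inv := fun f => rfl }
  rw [← Nat.card_congr e, Nat.card_fun]
  simp

/-- The transfer matrix of the cap and cup `eᵢ` on two-colourings of the three positions of a level: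
the entry is `1` if the colours `f` before and `g` after the crossing are constant along the arcs,
and `0` otherwise. -/
def turnMatrix (i : Fin 2) : Matrix (Fin 3 → Bool) (Fin 3 → Bool) ℕ := fun f g =>
  if f i.castSucc = f i.succ ∧ g i.castSucc = g i.succ ∧
    ∀ j : Fin 3, j ≠ i.castSucc → j ≠ i.succ → f j = g j then 1 else 0

theorem isTemperleyLieb_turnMatrix : IsTemperleyLieb 2 turnMatrix where
  comm i := Nat.cast_commute 2 (turnMatrix i)
  mul_self i := by
    rw [two_mul]
    revert i
    decide +kernel
  mul_mul i j h := by
    revert i j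
    decide +kernel

theorem trace_turnMatrix (i : Fin 2) : (turnMatrix i).trace = 4 := by
  revert i
  decide +kernel

theorem trace_turnMatrix_mul (i j : Fin 2) (h : i ≠ j) :
    (turnMatrix i * turnMatrix j).trace = 2 := by
  revert i j
  decide +kernel

/-- A colouring is constant on the arcs of a state exactly if the colours of consecutive levels are
compatible with the smoothed crossing between them and those of the last and the first level
agree. -/
theorem forall_stateArc_iff (u : BraidWord 3) (s : u.State)
    (F : Fin (u.length + 1) → Fin 3 → Bool) :
    (∀ p q, u.StateArc s p q → F p.2 p.1 = F q.2 q.1) ↔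
      F (Fin.last _) = F 0 ∧ ∀ k : Fin u.length,
        (if s k then 1 else turnMatrix (u.get k).1 : Matrix _ _ ℕ)
          (F k.castSucc) (F k.succ) = 1 := by
  constructor
  · intro h
    refine ⟨funext fun j => h _ _ (.close j), fun k => ?_⟩
    cases hs : s k with
    | true =>
      have : F k.castSucc = F k.succ := funext fun j => h _ _ (.pass k j (.inl hs))
      rw [if_pos rfl, Matrix.one_apply, if_pos this]
    | false =>
      simp only [Bool.false_eq_true, if_false, turnMatrix]
      rw [if_pos]
      refine ⟨h _ _ (.cap k hs _ _ rfl rfl), h _ _ (.cup k hs _ _ rfl rfl), fun j h1 h2 => ?_⟩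
      refine h _ _ (.pass k j (.inr ⟨fun h' => h1 (Fin.ext h'), fun h' => h2 (Fin.ext h')⟩))
  · rintro ⟨h0, h⟩ p q hpq
    have key : ∀ k, (s k = true → F k.castSucc = F k.succ) ∧
        (s k = false → (F k.castSucc (Fin.castSucc (n := 2) (u.get k).1)
            = F k.castSucc (Fin.succ (n := 2) (u.get k).1)) ∧
          (F k.succ (Fin.castSucc (n := 2) (u.get k).1)
            = F k.succ (Fin.succ (n := 2) (u.get k).1)) ∧
          ∀ j : Fin 3, j ≠ Fin.castSucc (n := 2) (u.get k).1 →
            j ≠ Fin.succ (n := 2) (u.get k).1 → F k.castSucc j = F k.succ j) := by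
      intro k
      have hk := h k
      refine ⟨fun hs => ?_, fun hs => ?_⟩
      · simp only [hs, if_true, Matrix.one_apply] at hk
        by_contra hne
        simp [hne] at hk
      · simp only [hs, Bool.false_eq_true, if_false, turnMatrix] at hk
        by_contra hne
        rw [if_neg hne] at hk
        exact zero_ne_one hk
    cases hpq with
    | pass k j hj =>
      cases hs : s k with
      | true => exact congrFun ((key k).1 hs) j
      | false =>
        simp only [hs, Bool.false_eq_true, false_or] at hj
        exact ((key k).2 hs).2.2 j (fun h' => hj.1 (by rw [h']; rfl))
          (fun h' => hj.2 (by rw [h']; rfl))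
    | cap k hs j j' hj hj' =>
      have h1 : j = Fin.castSucc (n := 2) (u.get k).1 := Fin.ext hj
      have h2 : j' = Fin.succ (n := 2) (u.get k).1 := Fin.ext hj'
      rw [h1, h2]; exact ((key k).2 hs).1
    | cup k hs j j' hj hj' =>
      have h1 : j = Fin.castSucc (n := 2) (u.get k).1 := Fin.ext hj
      have h2 : j' = Fin.succ (n := 2) (u.get k).1 := Fin.ext hj'
      rw [h1, h2]; exact ((key k).2 hs).2.1
    | close j => exact congrFun h0 j

/-- The number of circles of a state as the trace of a product of transfer matrices. -/
theorem two_pow_circles (u : BraidWord 3) (s : u.State) :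
    2 ^ u.circles s = (List.ofFn fun k : Fin u.length =>
      (if s k then 1 else turnMatrix (u.get k).1 : Matrix (Fin 3 → Bool) _ ℕ)).prod.trace := by
  classical
  rw [BraidWord.circles, two_pow_card_quot, trace_prod_ofFn]
  have hval : ∀ (k : Fin u.length) (f g : Fin 3 → Bool),
      (if s k then 1 else turnMatrix (u.get k).1 : Matrix _ _ ℕ) f g = 1 ∨
      (if s k then 1 else turnMatrix (u.get k).1 : Matrix _ _ ℕ) f g = 0 := by
    intro k f g
    cases s k with
    | true => simp only [if_true, Matrix.one_apply]; split_ifs <;> simp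
    | false => simp only [Bool.false_eq_true, if_false, turnMatrix]; split_ifs <;> simp
  have e : {f : Fin 3 × Fin (u.length + 1) → Bool // ∀ a b, u.StateArc s a b → f a = f b} ≃
      {F : Fin (u.length + 1) → Fin 3 → Bool //
        ∀ p q, u.StateArc s p q → F p.2 p.1 = F q.2 q.1} :=
    { toFun := fun f => ⟨fun k j => f.1 (j, k), fun p q h => f.2 p q h⟩
      invFun := fun F => ⟨fun p => F.1 p.2 p.1, F.2⟩
      left_inv := fun f => rfl
      right_inv := fun F => rfl }
  rw [Nat.card_congr e, Nat.card_eq_fintype_card, Fintype.card_subtype,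
    Finset.card_filter]
  refine Finset.sum_congr rfl fun F _ => ?_
  simp only [forall_stateArc_iff, ite_and]
  split_ifs with _ h1
  · exact (Finset.prod_eq_one fun k _ => h1 k).symm
  · push Not at h1
    obtain ⟨k, hk⟩ := h1
    exact (Finset.prod_eq_zero (Finset.mem_univ k) ((hval k _ _).resolve_left hk)).symm
  · rfl

/-! ### The two-dimensional Temperley–Lieb representation -/

/-- The loop value `d = -A² - A⁻²`. -/
def loopValue {K : Type*} [Field K] (A : K) : K := -A ^ 2 - A ^ (-2 : ℤ)

/-- A two-dimensional representation of the Temperley–Lieb algebra on three strands with loop value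
`-A² - A⁻²`. The off-diagonal entries are chosen such that `-(1 + A⁻² eᵢ)` only involves
`t = A⁻⁴`. -/
def tlMatrix {K : Type*} [Field K] (A : K) (i : Fin 2) : Matrix (Fin 2) (Fin 2) K :=
  if i = 0 then !![loopValue A, A ^ 2; 0, 0] else !![0, 0; A ^ (-2 : ℤ), loopValue A]

theorem isTemperleyLieb_tlMatrix {K : Type*} [Field K] {A : K} (hA : A ≠ 0) :
    IsTemperleyLieb (algebraMap K _ (loopValue A)) (tlMatrix A) where
  comm i := Algebra.commutes _ _
  mul_self i := by
    rw [← Algebra.smul_def]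
    fin_cases i <;> simp [tlMatrix, funext_iff, Fin.forall_fin_two]
  mul_mul i j h := by
    have hij : (i = 0 ∧ j = 1) ∨ (i = 1 ∧ j = 0) := by omega
    rcases hij with ⟨rfl, rfl⟩ | ⟨rfl, rfl⟩ <;>
      simp [tlMatrix, funext_iff, Fin.forall_fin_two, hA]

theorem trace_tlMatrix {K : Type*} [Field K] (A : K) (i : Fin 2) :
    (tlMatrix A i).trace = loopValue A := by
  fin_cases i <;> simp [tlMatrix, Matrix.trace_fin_two]

theorem trace_tlMatrix_mul {K : Type*} [Field K] {A : K} (hA : A ≠ 0) (i j : Fin 2) (h : i ≠ j) :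
    (tlMatrix A i * tlMatrix A j).trace = 1 := by
  have hij : (i = 0 ∧ j = 1) ∨ (i = 1 ∧ j = 0) := by omega
  rcases hij with ⟨rfl, rfl⟩ | ⟨rfl, rfl⟩ <;>
    simp [tlMatrix, Matrix.trace_fin_two, hA]

/-- The circle weight of a state is a Temperley–Lieb trace. The closure trace of the algebra on
three strands is the trace of the two-dimensional representation plus `d² - 2` times the
one-dimensional one, in which all `eᵢ` act by zero. -/
theorem loopValue_pow_circles {K : Type} [Field K] {A : K} (hA : A ≠ 0) (u : BraidWord 3)
    (s : u.State) :
    loopValue A ^ (u.circles s - 1) = (List.ofFn fun k : Fin u.length =>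
      (if s k then 1 else tlMatrix A (u.get k).1)).prod.trace +
        if ∀ k, s k = true then loopValue A ^ 2 - 2 else 0 := by
  let L : List (Fin 2 × Bool) := List.ofFn fun k : Fin u.length => ((u.get k).1, s k)
  have hL : ∀ {R : Type} [Monoid R] (e : Fin 2 → R),
      (List.ofFn fun k : Fin u.length => (if s k then 1 else e (u.get k).1))
        = L.map fun p => if p.2 then 1 else e p.1 := by
    intro R _ e
    simp only [L, List.map_ofFn]
    rfl
  have hc := two_pow_circles u s
  rw [hL turnMatrix] at hc
  rw [hL]
  rcases exists_normalForm L with h | ⟨⟨p, hp, hb⟩, l, i, j, h⟩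
  · -- all smoothings are parallel: three circles, of weight `d² = 2 + (d² - 2)`
    have h1 : ∀ {R : Type} [Monoid R] (e : Fin 2 → R),
        (L.map fun p => if p.2 then 1 else e p.1).prod = 1 := by
      intro R _ e
      refine List.prod_eq_one fun x hx => ?_
      obtain ⟨p, hp, rfl⟩ := List.mem_map.1 hx
      simp [h p hp]
    have h2 : ∀ k, s k = true := fun k => h _ (List.mem_ofFn.2 ⟨k, rfl⟩)
    rw [h1] at hc ⊢
    have h3 : u.circles s = 3 := by
      apply Nat.pow_right_injective le_rfl
      simp only [hc]
      simp [Matrix.trace_one]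
    rw [if_pos h2, h3, Matrix.trace_one]
    simp
  · have h2 : ¬ ∀ k, s k = true := by
      obtain ⟨k, rfl⟩ := List.mem_ofFn.1 hp
      intro h2
      simp [h2 k] at hb
    rw [h _ _ _ isTemperleyLieb_turnMatrix] at hc
    rw [if_neg h2, add_zero, h _ _ _ (isTemperleyLieb_tlMatrix hA), ← map_pow,
      ← Algebra.smul_def, Matrix.trace_smul, smul_eq_mul]
    have h4 : ∀ M : Matrix (Fin 3 → Bool) (Fin 3 → Bool) ℕ,
        (2 ^ l * M).trace = 2 ^ l * M.trace := by
      intro M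
      have : (2 ^ l * M) = (2 ^ l : ℕ) • M := by rw [nsmul_eq_mul]; push_cast; rfl
      rw [this, Matrix.trace_smul, smul_eq_mul]
    rw [h4] at hc
    split_ifs at hc ⊢ with hij
    · have h3 : u.circles s = l + 2 := by
        apply Nat.pow_right_injective le_rfl
        simp only [hc, trace_turnMatrix, pow_add]
        norm_num
      rw [h3, trace_tlMatrix]
      simp [pow_succ]
    · have h3 : u.circles s = l + 1 := by
        apply Nat.pow_right_injective le_rfl
        simp only [hc, trace_turnMatrix_mul i j hij, pow_add]
        norm_num
      rw [h3, trace_tlMatrix_mul hA i j hij]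
      simp

/-! ### The bracket as a trace -/

/-- The variable `A` of the Kauffman bracket. -/
noncomputable def kauffmanA : JonesField := algebraMap ℤ[T;T⁻¹] JonesField (T 1)

theorem algebraMap_T (n : ℤ) : algebraMap ℤ[T;T⁻¹] JonesField (T n) = kauffmanA ^ n := by
  have hA : ∀ n : ℕ, algebraMap ℤ[T;T⁻¹] JonesField (T n) = kauffmanA ^ n := by
    intro n
    rw [kauffmanA, ← map_pow, T_pow, mul_one]
  obtain ⟨n, rfl | rfl⟩ := n.eq_nat_or_neg
  · rw [hA, zpow_natCast]
  · rw [zpow_neg, zpow_natCast, ← hA]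
    refine eq_inv_of_mul_eq_one_left ?_
    rw [← map_mul, ← T_add]
    simp

theorem kauffmanA_ne_zero : kauffmanA ≠ 0 := by
  intro h
  have h1 := algebraMap_T (-1 + 1)
  rw [T_add, map_mul] at h1
  have h2 : algebraMap ℤ[T;T⁻¹] JonesField (T 1) = 0 := h
  rw [h2, mul_zero] at h1
  simp at h1

theorem t_eq : t = kauffmanA ^ (-4 : ℤ) := algebraMap_T _

theorem t_ne_zero : t ≠ 0 := by
  rw [t_eq]
  exact zpow_ne_zero _ kauffmanA_ne_zero

theorem one_add_t_ne_zero : 1 + t ≠ 0 := by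
  have h : (1 + T (-4) : ℤ[T;T⁻¹]) ≠ 0 := by
    intro h
    have h1 := congrArg (eval₂ (Int.castRingHom ℤ) 1) h
    simp at h1
  rw [t, ← map_one (algebraMap ℤ[T;T⁻¹] JonesField), ← map_add]
  exact fun h' => h ((FaithfulSMul.algebraMap_injective _ _) (h'.trans (map_zero _).symm))

/-- The Kauffman expansion `A^{±1} + A^{∓1} eᵢ` of a letter of a braid word, in the
two-dimensional Temperley–Lieb representation. -/
noncomputable def kauffmanLetter (c : Fin 2 × Bool) : Matrix (Fin 2) (Fin 2) JonesField :=
  let z : ℤ := if c.2 then 1 else -1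
  kauffmanA ^ z • 1 + kauffmanA ^ (-z) • tlMatrix kauffmanA c.1

theorem prod_ofFn_smul {R M : Type*} [CommSemiring R] [Semiring M] [Algebra R M] {n : ℕ}
    (w : Fin n → R) (m : Fin n → M) :
    (List.ofFn fun k => w k • m k).prod = (∏ k, w k) • (List.ofFn m).prod := by
  induction n with
  | zero => simp
  | succ n ih => simp [List.ofFn_succ, Fin.prod_univ_succ, ih, smul_smul, mul_comm]

theorem prod_map_zpow_writhe {K : Type*} [Field K] {A : K} (hA : A ≠ 0) (u : BraidWord 3) :
    (u.map fun c => A ^ (if c.2 then 1 else -1 : ℤ)).prod = A ^ u.writhe := by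
  induction u with
  | nil => simp [BraidWord.writhe]
  | cons c u ih =>
    simp only [BraidWord.writhe, List.map_cons, List.prod_cons, List.sum_cons] at ih ⊢
    rw [ih, zpow_add₀ hA]

/-- The bracket as a trace, by expanding the product of the letters over all states. -/
theorem map_bracket (u : BraidWord 3) :
    algebraMap ℤ[T;T⁻¹] JonesField u.bracket =
      (u.map kauffmanLetter).prod.trace +
        kauffmanA ^ u.writhe * (loopValue kauffmanA ^ 2 - 2) := by
  have hA := kauffmanA_ne_zero
  have hd : algebraMap ℤ[T;T⁻¹] JonesField (-T 2 - T (-2)) = loopValue kauffmanA := by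
    rw [map_sub, map_neg, algebraMap_T, algebraMap_T, loopValue]
    rfl
  let w (k : Fin u.length) (b : Bool) : JonesField :=
    if b = (u.get k).2 then kauffmanA else kauffmanA⁻¹
  have hw : ∀ (k : Fin u.length) (b : Bool), algebraMap ℤ[T;T⁻¹] JonesField
      (if b = (u.get k).2 then T 1 else T (-1)) = w k b := by
    intro k b
    rw [apply_ite (algebraMap ℤ[T;T⁻¹] JonesField), algebraMap_T, algebraMap_T]
    simp [w]
  rw [BraidWord.bracket]
  simp only [map_sum, map_mul, map_prod, map_pow, hd, hw, loopValue_pow_circles hA, mul_add,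
    Finset.sum_add_distrib]
  congr 1
  · have h1 : ∀ s : u.State, (∏ k, w k (s k)) * (List.ofFn fun k : Fin u.length =>
        (if s k then 1 else tlMatrix kauffmanA (u.get k).1)).prod.trace =
        ((List.ofFn fun k : Fin u.length =>
          w k (s k) • (if s k then 1 else tlMatrix kauffmanA (u.get k).1))).prod.trace := by
      intro s
      rw [← smul_eq_mul, ← Matrix.trace_smul]
      rw [prod_ofFn_smul]
    simp only [h1]
    rw [← Matrix.trace_sum, sum_prod_ofFn (fun k b => w k b • (if b = true then
      (1 : Matrix (Fin 2) (Fin 2) JonesField) else tlMatrix kauffmanA (u.get k).1))]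
    congr 2
    conv_rhs => rw [← List.ofFn_get u, List.map_ofFn]
    congr 1
    funext k
    simp only [Fintype.sum_bool, w, kauffmanLetter, Function.comp]
    cases (u.get k).2 <;> simp
  · rw [Finset.sum_eq_single (fun _ => true)]
    · simp only [implies_true, if_true]
      rw [← prod_map_zpow_writhe hA u, ← Fin.prod_univ_fun_getElem]
      refine congrArg (· * _) (Finset.prod_congr rfl fun k _ => ?_)
      simp only [w, List.get_eq_getElem]
      cases u[k].2 <;> simp
    · intro s _ hs
      rw [if_neg, mul_zero]
      exact fun h => hs (funext h)
    · simp

/-! ### The Burau representation and the Jones polynomial -/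

/-- The reduced Burau matrices of `σ₁` (index `0`) and `σ₂` (index `1`), with eigenvalues `t` and
`-1`. They equal `-A⁻¹ (A + A⁻¹ eᵢ)` for the Temperley–Lieb matrices `eᵢ = tlMatrix A i`. -/
noncomputable def burauGen (i : Fin 2) : (Matrix (Fin 2) (Fin 2) JonesField)ˣ where
  val := if i = 0 then !![t, -1; 0, -1] else !![-1, 0; -t, t]
  inv := if i = 0 then !![t⁻¹, -t⁻¹; 0, -1] else !![-1, 0; -1, t⁻¹]
  val_inv := by
    fin_cases i <;> simp [Matrix.one_fin_two, t_ne_zero]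
  inv_val := by
    fin_cases i <;> simp [Matrix.one_fin_two, t_ne_zero]

theorem burauGen_braid :
    burauGen 0 * burauGen 1 * burauGen 0 = burauGen 1 * burauGen 0 * burauGen 1 := by
  ext i j
  fin_cases i <;> fin_cases j <;> simp [burauGen]

/-- In `B_3` the braid relation is the only relation. -/
theorem lift_eq_one_of_braid {G : Type*} [Group G] (g : Fin 2 → G)
    (h : g 0 * g 1 * g 0 = g 1 * g 0 * g 1) :
    ∀ r ∈ {r | IsBraidRel 3 r}, FreeGroup.lift (β := G) g r = 1 := by
  rintro r (⟨i, j, hij⟩ | ⟨i, j, hij⟩)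
  · have := j.isLt
    omega
  · obtain ⟨i, hi⟩ := i
    obtain ⟨j, hj⟩ := j
    obtain rfl : i = 0 := by simp only at hij; omega
    obtain rfl : j = 1 := hij.symm
    rw [map_mul, map_inv, mul_inv_eq_one]
    simpa using h

/-- The reduced Burau representation of `B_3`. -/
noncomputable def burau : BraidGroup 3 →* (Matrix (Fin 2) (Fin 2) JonesField)ˣ :=
  PresentedGroup.toGroup (lift_eq_one_of_braid burauGen burauGen_braid)

/-- The homomorphism `β ↦ ε_{w(β)}`, where `w(β)` is the exponent sum of `β`. -/
noncomputable def signHom : BraidGroup 3 →* JonesFieldˣ :=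
  PresentedGroup.toGroup (lift_eq_one_of_braid (fun _ => -1) rfl)

theorem toGroup_toBraid {G : Type*} [Group G] (g : Fin 2 → G)
    (h : g 0 * g 1 * g 0 = g 1 * g 0 * g 1) (u : BraidWord 3) :
    PresentedGroup.toGroup (lift_eq_one_of_braid g h) u.toBraid =
      (u.map fun c => if c.2 then g c.1 else (g c.1)⁻¹).prod := by
  change FreeGroup.lift (β := G) g (FreeGroup.mk u) = _
  rw [FreeGroup.lift_mk]
  congr 2
  funext c
  cases c.2 <;> rfl

theorem burau_sigma₁ : burau sigma₁ = burauGen 0 := PresentedGroup.toGroup.of _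

theorem burau_sigma₂ : burau sigma₂ = burauGen 1 := PresentedGroup.toGroup.of _

theorem signHom_sigma₁ : signHom sigma₁ = -1 := PresentedGroup.toGroup.of _

theorem signHom_sigma₂ : signHom sigma₂ = -1 := PresentedGroup.toGroup.of _

theorem val_list_prod {M : Type*} [Monoid M] (l : List Mˣ) :
    (l.prod : M) = (l.map Units.val).prod :=
  map_list_prod (Units.coeHom M) l

theorem signHom_toBraid (u : BraidWord 3) : (signHom u.toBraid : JonesField) = eps u.writhe := by
  rw [signHom, toGroup_toBraid _ rfl, eps, ← prod_map_zpow_writhe (neg_ne_zero.2 one_ne_zero),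
    val_list_prod, List.map_map]
  congr 2
  funext c
  cases c.2 <;> simp

/-- The factor `-A⁻³` of a crossing in the Jones polynomial and the factor `A²` in `V*` together
turn the Kauffman expansion of a letter into its Burau matrix. -/
theorem smul_kauffmanLetter (c : Fin 2 × Bool) :
    (-kauffmanA⁻¹) ^ (if c.2 then 1 else -1 : ℤ) • kauffmanLetter c =
      ((if c.2 then burauGen c.1 else (burauGen c.1)⁻¹ :
        (Matrix (Fin 2) (Fin 2) JonesField)ˣ) : Matrix (Fin 2) (Fin 2) JonesField) := by
  have hA := kauffmanA_ne_zero
  obtain ⟨i, b⟩ := c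
  ext k l
  cases b <;> fin_cases i <;> fin_cases k <;> fin_cases l <;>
    simp [kauffmanLetter, burauGen, tlMatrix, loopValue, t_eq] <;> field_simp <;> ring

theorem burau_toBraid (u : BraidWord 3) :
    (burau u.toBraid : Matrix (Fin 2) (Fin 2) JonesField) =
      (-kauffmanA⁻¹) ^ u.writhe • (u.map kauffmanLetter).prod := by
  have hA := kauffmanA_ne_zero
  rw [burau, toGroup_toBraid _ burauGen_braid, val_list_prod, List.map_map,
    ← prod_map_zpow_writhe (neg_ne_zero.2 (inv_ne_zero hA))]
  induction u with
  | nil => simp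
  | cons c u ih =>
    simp only [List.map_cons, List.prod_cons, ih, Function.comp_apply, ← smul_kauffmanLetter,
      smul_mul_smul_comm]

/-- `V*` as a function of the braid only: `ε_w (1 + t²) + t · tr (Burau matrix)`. -/
theorem normalizedJones_eq (u : BraidWord 3) :
    u.normalizedJones = signHom u.toBraid * (1 + t ^ 2) +
      t * (burau u.toBraid : Matrix (Fin 2) (Fin 2) JonesField).trace := by
  have hA := kauffmanA_ne_zero
  have hC : algebraMap ℤ[T;T⁻¹] JonesField (C (u.writhe.negOnePow : ℤ)) = (-1) ^ u.writhe := by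
    rcases Int.even_or_odd u.writhe with h | h
    · simp [Int.negOnePow_even _ h, h.neg_one_zpow]
    · simp [Int.negOnePow_odd _ h, h.neg_one_zpow]
  rw [signHom_toBraid, burau_toBraid, Matrix.trace_smul, BraidWord.normalizedJones,
    BraidWord.jones, map_mul, map_mul, map_mul, hC, algebraMap_T, algebraMap_T, map_bracket, eps,
    t_eq, loopValue, smul_eq_mul]
  generalize (u.map kauffmanLetter).prod.trace = τ
  generalize u.writhe = w
  rw [neg_eq_neg_one_mul kauffmanA⁻¹, mul_zpow, inv_zpow]
  have e1 : kauffmanA ^ (2 * (w - 2)) = (kauffmanA ^ w) ^ 2 * kauffmanA ^ (-4 : ℤ) := by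
    rw [← zpow_natCast, ← zpow_mul, ← zpow_add₀ hA]; congr 1; push_cast; ring
  have e2 : kauffmanA ^ (-3 * w) = (kauffmanA ^ w)⁻¹ ^ 3 := by
    rw [← zpow_neg, ← zpow_natCast, ← zpow_mul]; congr 1; push_cast; ring
  rw [e1, e2]
  have hw : kauffmanA ^ w ≠ 0 := zpow_ne_zero _ hA
  generalize kauffmanA ^ w = q at *
  field_simp
  ring

/-! ### Evaluation on `(σ₁σ₂)^{3a} σ₁^x σ₂^y` -/

theorem burauGen_zero_zpow (x : ℤ) :
    ((burauGen 0 ^ x : (Matrix (Fin 2) (Fin 2) JonesField)ˣ) : Matrix (Fin 2) (Fin 2) JonesField) =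
      !![t ^ x, -((t ^ x - eps x) / (1 + t)); 0, eps x] := by
  have h1 := one_add_t_ne_zero
  have h0 := t_ne_zero
  induction x with
  | zero => simp [eps, Matrix.one_fin_two]
  | succ n ih =>
    rw [zpow_add_one, Units.val_mul, ih]
    simp only [eps, zpow_add_one₀ h0, zpow_add_one₀ (neg_ne_zero.2 (one_ne_zero (α := JonesField)))]
    ext i j
    fin_cases i <;> fin_cases j <;> simp [burauGen]
    field_simp
    ring
  | pred n ih =>
    rw [zpow_sub_one, Units.val_mul, ih]
    simp only [eps, zpow_sub_one₀ h0, zpow_sub_one₀ (neg_ne_zero.2 (one_ne_zero (α := JonesField)))]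
    ext i j
    fin_cases i <;> fin_cases j <;> simp [burauGen]
    field_simp
    ring

theorem burauGen_one_zpow (x : ℤ) :
    ((burauGen 1 ^ x : (Matrix (Fin 2) (Fin 2) JonesField)ˣ) : Matrix (Fin 2) (Fin 2) JonesField) =
      !![eps x, 0; -(t * ((t ^ x - eps x) / (1 + t))), t ^ x] := by
  have h1 := one_add_t_ne_zero
  have h0 := t_ne_zero
  induction x with
  | zero => simp [eps, Matrix.one_fin_two]
  | succ n ih =>
    rw [zpow_add_one, Units.val_mul, ih]
    simp only [eps, zpow_add_one₀ h0, zpow_add_one₀ (neg_ne_zero.2 (one_ne_zero (α := JonesField)))]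
    ext i j
    fin_cases i <;> fin_cases j <;> simp [burauGen]
    field_simp
    ring
  | pred n ih =>
    rw [zpow_sub_one, Units.val_mul, ih]
    simp only [eps, zpow_sub_one₀ h0, zpow_sub_one₀ (neg_ne_zero.2 (one_ne_zero (α := JonesField)))]
    ext i j
    fin_cases i <;> fin_cases j <;> simp [burauGen]
    field_simp
    ring

/-- The full twist `(σ₁σ₂)³` acts as the scalar `t³`. -/
theorem burau_fullTwist_zpow (a : ℤ) :
    (burau ((sigma₁ * sigma₂) ^ (3 * a)) : Matrix (Fin 2) (Fin 2) JonesField) =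
      t ^ (3 * a) • (1 : Matrix (Fin 2) (Fin 2) JonesField) := by
  let z : JonesFieldˣ := Units.mk0 t t_ne_zero
  have h : (burauGen 0 * burauGen 1) ^ (3 : ℤ) =
      Units.map (algebraMap JonesField (Matrix (Fin 2) (Fin 2) JonesField)).toMonoidHom
        (z ^ 3) := by
    ext i j
    change _ = (algebraMap JonesField (Matrix (Fin 2) (Fin 2) JonesField)) (t ^ 3) i j
    rw [zpow_ofNat, Matrix.algebraMap_matrix_apply]
    fin_cases i <;> fin_cases j <;> simp [burauGen, pow_succ]
  rw [map_zpow, map_mul, burau_sigma₁, burau_sigma₂, zpow_mul, h, ← map_zpow, ← zpow_natCast,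
    ← zpow_mul, Algebra.smul_def, mul_one]
  change algebraMap JonesField (Matrix (Fin 2) (Fin 2) JonesField) ((z ^ (3 * a) : JonesFieldˣ)) = _
  rw [Units.val_zpow_eq_zpow_val]
  rfl

theorem signHom_apply (a x y : ℤ) :
    (signHom ((sigma₁ * sigma₂) ^ (3 * a) * sigma₁ ^ x * sigma₂ ^ y) : JonesField) =
      eps (x + y) := by
  simp [signHom_sigma₁, signHom_sigma₂, eps, zpow_add₀]

/-- The value of `V*` on closures of braids conjugate to `(σ₁σ₂)^{3a} σ₁^x σ₂^y`. -/
theorem normalizedJones_of_toBraid_isConj {u : BraidWord 3} {a x y : ℤ}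
    (h : IsConj u.toBraid ((sigma₁ * sigma₂) ^ (3 * a) * sigma₁ ^ x * sigma₂ ^ y)) :
    u.normalizedJones = eps (x + y) * (1 + t ^ 2) + t ^ (3 * a) *
      (t ^ (x + y + 2) + eps x * G * t ^ (y + 1) + eps y * G * t ^ (x + 1)
        + eps (x + y) * t ^ 2) / (1 + t) ^ 2 := by
  have h0 := t_ne_zero
  have h1 := one_add_t_ne_zero
  have hs : signHom u.toBraid = signHom ((sigma₁ * sigma₂) ^ (3 * a) * sigma₁ ^ x * sigma₂ ^ y) :=
    isConj_iff_eq.1 (signHom.map_isConj h)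
  have hb : (burau u.toBraid : Matrix (Fin 2) (Fin 2) JonesField).trace =
      (burau ((sigma₁ * sigma₂) ^ (3 * a) * sigma₁ ^ x * sigma₂ ^ y) :
        Matrix (Fin 2) (Fin 2) JonesField).trace := by
    obtain ⟨c, hc⟩ := isConj_iff.1 (burau.map_isConj h)
    rw [← hc, Units.val_mul, Units.val_mul, Matrix.trace_mul_comm, ← mul_assoc, Units.inv_mul,
      one_mul]
  have hm : (-1 : JonesField) ≠ 0 := neg_ne_zero.2 one_ne_zero
  rw [normalizedJones_eq, hs, hb, signHom_apply, map_mul, map_mul, Units.val_mul,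
    Units.val_mul, burau_fullTwist_zpow, map_zpow, map_zpow, burau_sigma₁, burau_sigma₂,
    burauGen_zero_zpow, burauGen_one_zpow]
  simp only [Matrix.trace_fin_two, eps, zpow_add₀ h0, zpow_add₀ hm, G]
  simp
  generalize (-1 : JonesField) ^ x = p
  generalize (-1 : JonesField) ^ y = q
  generalize t ^ (3 * a) = r
  generalize t ^ x = X
  generalize t ^ y = Y
  field_simp
  ring

/-! ### Conjugacies in groups with a braid relation -/

section Conjugation

variable {H : Type*} [Group H] {g h : H}

theorem braid_mul_zpow (hb : g * h * g = h * g * h) (x : ℤ) : g * h * g ^ x = h ^ x * (g * h) := by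
  have : SemiconjBy (g * h) g h := by
    simpa [SemiconjBy, mul_assoc] using hb
  exact (this.zpow_right x).eq

/-- Powers of the full twist `(gh)³` commute with `g` and `h`. -/
theorem commute_fullTwist (hb : g * h * g = h * g * h) (a : ℤ) (k : H)
    (hk : k = g ∨ k = h) : Commute ((g * h) ^ (3 * a)) k := by
  have h1 : SemiconjBy (g * h) g h := by
    simpa [SemiconjBy, mul_assoc] using hb
  have h2 : SemiconjBy ((g * h) ^ 2) h g := by
    have e1 : h * (g * (h * h)) = g * (h * (g * h)) := by
      simpa [mul_assoc] using congrArg (· * h) hb.symm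
    simp [SemiconjBy, pow_two, mul_assoc, e1]
  rw [zpow_mul]
  refine Commute.zpow_left ?_ a
  have h3 : (g * h) ^ (3 : ℤ) = (g * h) ^ 2 * (g * h) := by rw [zpow_ofNat, pow_succ]
  have h4 : (g * h) ^ (3 : ℤ) = (g * h) * (g * h) ^ 2 := by rw [zpow_ofNat, pow_succ']
  rcases hk with rfl | rfl
  · rw [h3]; exact h2.mul_left h1
  · rw [h4]; exact h1.mul_left h2

theorem isConj_mul_swap (p q : H) : IsConj (p * q) (q * p) :=
  isConj_iff.2 ⟨p⁻¹, by group⟩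

/-- Sliding `g ^ x` through `g * h` gives the conjugate `(gh)^{3a} g h^{x+y+1}`; the half twist
`g * h * g` exchanges `g` and `h`. -/
theorem isConj_fullTwist_mul_braid (hb : g * h * g = h * g * h) (a x y : ℤ) :
    IsConj ((g * h) ^ (3 * a + 1) * g ^ x * h ^ y) ((g * h) ^ (3 * a) * g ^ (x + y + 1) * h) := by
  have hg := commute_fullTwist hb a g (.inl rfl)
  have hh := commute_fullTwist hb a h (.inr rfl)
  rw [zpow_add_one]
  -- only the centrality of the power of the full twist is used
  generalize (g * h) ^ (3 * a) = z at *
  generalize hn : x + y + 1 = n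
  have e1 : z * (g * h) * g ^ x * h ^ y = h ^ x * (z * (g * h) * h ^ y) := by
    rw [mul_assoc z, braid_mul_zpow hb x, ← mul_assoc, (hh.zpow_right x).eq]
    simp only [mul_assoc]
  have e2 : z * (g * h) * h ^ y * h ^ x = z * (g * h ^ n) := by
    rw [← hn]
    group
  -- conjugation by the half twist exchanges `g` and `h`
  have e3 : SemiconjBy (g * h * g) g h := by
    simp only [SemiconjBy]
    nth_rewrite 1 [hb]
    simp only [mul_assoc]
  have e4 : SemiconjBy (g * h * g) h g := by
    simp only [SemiconjBy]
    nth_rewrite 2 [hb]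
    simp only [mul_assoc]
  have e5 : SemiconjBy (g * h * g) (z * (g * h ^ n)) (z * (h * g ^ n)) :=
    SemiconjBy.mul_right ((hg.mul_right hh).mul_right hg).symm (e3.mul_right (e4.zpow_right n))
  have e6 : z * (h * g ^ n) = h * (z * g ^ n) := by rw [← mul_assoc, hh.eq, mul_assoc]
  rw [e1]
  refine (isConj_mul_swap _ _).trans ?_
  rw [e2]
  refine (isConj_iff.2 ⟨g * h * g, mul_inv_eq_of_eq_mul e5.eq⟩ :
    IsConj _ (z * (h * g ^ n))).trans ?_
  rw [e6]
  exact isConj_mul_swap _ _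

/-- Cyclic rotation by `h⁻¹` together with `g * h * h⁻¹ = g`. -/
theorem isConj_fullTwist_mul_braid_sq (hb : g * h * g = h * g * h) (a x y : ℤ) :
    IsConj ((g * h) ^ (3 * a + 2) * g ^ x * h ^ y)
      ((g * h) ^ (3 * a + 3) * g ^ (x - 1) * h ^ (y - 1)) := by
  have hh := commute_fullTwist hb (a + 1) h (.inr rfl)
  rw [show 3 * (a + 1) = 3 * a + 2 + 1 by ring] at hh
  rw [show 3 * a + 3 = 3 * a + 2 + 1 by ring]
  have e1 : (g * h) ^ (3 * a + 2) * g ^ x * h ^ y =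
      h⁻¹ * ((g * h) ^ (3 * a + 2 + 1) * g ^ (x - 1) * h ^ y) := by
    rw [← mul_assoc, ← mul_assoc, ← hh.inv_right.eq, zpow_add_one, zpow_sub_one]
    group
  rw [e1]
  refine (isConj_mul_swap _ _).trans ?_
  rw [mul_assoc, ← zpow_sub_one]

end Conjugation

theorem sigma_braid : sigma₁ * sigma₂ * sigma₁ = sigma₂ * sigma₁ * sigma₂ :=
  mul_inv_eq_one.1 (PresentedGroup.one_of_mem
    (IsBraidRel.braid (n := 3) ⟨0, by omega⟩ ⟨1, by omega⟩ rfl))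

end BraidJones

open BraidJones in
theorem mainTheorem3 (a x y : ℤ) :
    (∀ u : BraidJones.BraidWord 3,
      u.toBraid = (BraidJones.sigma₁ * BraidJones.sigma₂) ^ (3 * a) *
        BraidJones.sigma₁ ^ x * BraidJones.sigma₂ ^ y →
      u.normalizedJones = BraidJones.eps (x + y) * (1 + BraidJones.t ^ 2) +
        BraidJones.t ^ (3 * a) *
          (BraidJones.t ^ (x + y + 2)
            + BraidJones.eps x * BraidJones.G * BraidJones.t ^ (y + 1)
            + BraidJones.eps y * BraidJones.G * BraidJones.t ^ (x + 1)
            + BraidJones.eps (x + y) * BraidJones.t ^ 2) / (1 + BraidJones.t) ^ 2 ∧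
      u.normalizedJones = BraidJones.eps (x + y) * (1 + BraidJones.t ^ 2) +
        BraidJones.t ^ (3 * a + 2) *
          (BraidJones.eps (x + y + 1)
            + BraidJones.eps y * BraidJones.altA (x - 1)
            + BraidJones.eps x * BraidJones.altA (y - 1)
            + BraidJones.t ^ 2 * BraidJones.altA (x - 1) * BraidJones.altA (y - 1))) ∧
    (IsConj
        ((BraidJones.sigma₁ * BraidJones.sigma₂) ^ (3 * a + 1) *
          BraidJones.sigma₁ ^ x * BraidJones.sigma₂ ^ y)
        ((BraidJones.sigma₁ * BraidJones.sigma₂) ^ (3 * a) *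
          BraidJones.sigma₁ ^ (x + y + 1) * BraidJones.sigma₂) ∧
      ∀ u : BraidJones.BraidWord 3,
        u.toBraid = (BraidJones.sigma₁ * BraidJones.sigma₂) ^ (3 * a + 1) *
          BraidJones.sigma₁ ^ x * BraidJones.sigma₂ ^ y →
        u.normalizedJones = BraidJones.eps (x + y) * (1 + BraidJones.t ^ 2) -
          BraidJones.t ^ (3 * a + 3) *
            (BraidJones.t ^ (x + y - 1) + BraidJones.eps (x + y)) / (1 + BraidJones.t) ∧
        u.normalizedJones = BraidJones.eps (x + y) * (1 + BraidJones.t ^ 2) -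
          BraidJones.t ^ (3 * a + 3) * BraidJones.altA (x + y - 1)) ∧
    (IsConj
        ((BraidJones.sigma₁ * BraidJones.sigma₂) ^ (3 * a + 2) *
          BraidJones.sigma₁ ^ x * BraidJones.sigma₂ ^ y)
        ((BraidJones.sigma₁ * BraidJones.sigma₂) ^ (3 * a + 3) *
          BraidJones.sigma₁ ^ (x - 1) * BraidJones.sigma₂ ^ (y - 1)) ∧
      ∀ u : BraidJones.BraidWord 3,
        u.toBraid = (BraidJones.sigma₁ * BraidJones.sigma₂) ^ (3 * a + 2) *
          BraidJones.sigma₁ ^ x * BraidJones.sigma₂ ^ y →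
        u.normalizedJones = BraidJones.eps (x + y) * (1 + BraidJones.t ^ 2) +
          BraidJones.t ^ (3 * a + 3) *
            (BraidJones.t ^ (x + y)
              + BraidJones.eps (x - 1) * BraidJones.G * BraidJones.t ^ y
              + BraidJones.eps (y - 1) * BraidJones.G * BraidJones.t ^ x
              + BraidJones.eps (x + y) * BraidJones.t ^ 2) / (1 + BraidJones.t) ^ 2) := by
  have h0 := t_ne_zero
  have h1 := one_add_t_ne_zero
  have hm : (-1 : JonesField) ≠ 0 := neg_ne_zero.2 one_ne_zero
  have c2 := isConj_fullTwist_mul_braid sigma_braid a x y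
  have c3 := isConj_fullTwist_mul_braid_sq sigma_braid a x y
  refine ⟨fun u hu => ?_, ⟨c2, fun u hu => ?_⟩, ⟨c3, fun u hu => ?_⟩⟩
  · have hV := normalizedJones_of_toBraid_isConj (by rw [hu] : IsConj u.toBraid _)
    refine ⟨hV, ?_⟩
    rw [hV]
    simp only [altA, eps, G, zpow_add₀ h0, zpow_add₀ hm, zpow_sub₀ h0, zpow_sub₀ hm, add_comm t 1,
      zpow_ofNat]
    field_simp
    ring
  · have hV := normalizedJones_of_toBraid_isConj
      (by rw [hu, zpow_one]; exact c2 : IsConj u.toBraid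
        ((sigma₁ * sigma₂) ^ (3 * a) * sigma₁ ^ (x + y + 1) * sigma₂ ^ (1 : ℤ)))
    rw [hV]
    constructor <;>
    · simp only [altA, eps, G, zpow_add₀ h0, zpow_add₀ hm, zpow_sub₀ h0, zpow_sub₀ hm,
        add_comm t 1, zpow_ofNat]
      field_simp
      ring
  · have hV := normalizedJones_of_toBraid_isConj
      (by rw [hu, show 3 * (a + 1) = 3 * a + 3 by ring]; exact c3 :
        IsConj u.toBraid ((sigma₁ * sigma₂) ^ (3 * (a + 1)) * _ * _))
    rw [hV, show 3 * (a + 1) = 3 * a + 3 by ring]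
    simp only [eps, G, zpow_add₀ h0, zpow_add₀ hm, zpow_sub₀ h0, zpow_sub₀ hm,
      zpow_ofNat]
    field_simp
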